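/- **Uniform marginals lemma.** Logarithms are to base 2. For $b,n\in\mathbb N$ let $\Lambda=\{0,1\}^b$; for $x\in\Lambda^n$ and $I\subseteq[n]$ write $x_I$ for the projection of $x$ to the coordinates in $I$. For $g:\Lambda\times\Lambda\to\{0,1\}$ write $g^I(x_I,y_I)=(g(x_i,y_i))_{i\in I}$ and $G=g^{[n]}:\Lambda^n\times\Lambda^n\to\{0,1\}^n$. Definitions. * The discrepancy of $g$ is $$\mathrm{disc}(g)=\max_{A,B\subseteq\Lambda}\Big|\Pr[g(U,V)=0,\ (U,V)\in A\times B]-\Pr[g(U,V)=1,\ (U,V)\in A\times B]\Big|,$$ where $U,V$ are independent and uniform on $\Lambda$. * The min-entropy $H_\infty(W)$ of a random variable $W$ is the largest $k\in\mathbb R$ with $\Pr[W=w]\le 2^{-k}$ for every value $w$. A random variable $W$ with values in $\Lambda^J$ is $\delta$-dense if $H_\infty(W_I)\ge\delta\, b\,|I|$ for every $I\subseteq J$. * A restriction is a string $\rho\in\{0,1,*\}^n$, with $\mathrm{free}(\rho)=\{i:\rho_i=*\}$ and $\mathrm{fix}(\rho)=[n]\setminus\mathrm{free}(\rho)$. A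 string $z\in\{0,1\}^n$ is consistent with $\rho$ if $z_{\mathrm{fix}(\rho)}=\rho_{\mathrm{fix}(\rho)}$. * For $\tau>0$, independent random variables $X,Y$ with values in $\Lambda^n$ are $(\rho,\tau)$-structured if there are $\delta_X,\delta_Y>0$ with $\delta_X+\delta_Y\ge\tau$ such that $X_{\mathrm{free}(\rho)}$ is $\delta_X$-dense and $Y_{\mathrm{free}(\rho)}$ is $\delta_Y$-dense, and $g^{\mathrm{fix}(\rho)}(X_{\mathrm{fix}(\rho)},Y_{\mathrm{fix}(\rho)})=\rho_{\mathrm{fix}(\rho)}$ with probability $1$. * Two distributions $\mu_1,\mu_2$ on a finite set are $\varepsilon$-close if $\max_E|\mu_1(E)-\mu_2(E)|\le\varepsilon$, the maximum being over all events $E$; random variables are $\varepsilon$-close if their distributions are. Statement. There is a universal constant $h>0$ such that the following holds for every real $\eta>0$, every integer $c\ge1$, all $n\ge2$ and $b$ with $b\ge c\log n$, and every $g:\{0,1\}^b\times\{0,1\}^b\to\{0,1\}$ with $\mathrm{disc}(g)\le2^{-\eta b}$. Let $\gamma>0$, let $\rho\in\{0,1,*\}^n$ be a restriction and let $z\in\{0,1\}^n$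 be consistent with $\rho$. Let $X,Y$ be independent random variables uniformly distributed over sets $\mathcal X,\mathcal Y\subseteq\Lambda^n$ respectively, and assume that they are $(\rho,\tau)$-structured, where $$\tau\ge 2+\frac hc-\eta+\gamma.$$ Then $G^{-1}(z)\cap(\mathcal X\times\mathcal Y)$ is non-empty, and if $(X',Y')$ is uniformly distributed over this set, then $X$ is $2^{-\gamma b}$-close to $X'$ and $Y$ is $2^{-\gamma b}$-close to $Y'$. -/

import Mathlib

open MeasureTheory ProbabilityTheory

namespace Lifting

/-- The block alphabet: bit strings of length `b`. -/
abbrev Block (b : ℕ) : Type := Fin b → Bool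

/-- Blockwise application of the gadget to index set `ι`: `(g (x i, y i))_{i ∈ ι}`. -/
def blockwise {Λ ι : Type*} (g : Λ → Λ → Bool) (x y : ι → Λ) : ι → Bool :=
  fun i => g (x i) (y i)

/-- Discrepancy of `g` with respect to the rectangle `A × B`:
`|Pr[g(U,V) = 0 and (U,V) ∈ A × B] - Pr[g(U,V) = 1 and (U,V) ∈ A × B]|`
for `(U,V)` uniform on `Λ × Λ`. -/
noncomputable def rectDisc {Λ : Type*} [Fintype Λ] (g : Λ → Λ → Bool) (A B : Finset Λ) : ℝ :=
  |(((A ×ˢ B).filter (fun p => g p.1 p.2 = false)).card : ℝ) / (Fintype.card (Λ × Λ) : ℝ)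
    - (((A ×ˢ B).filter (fun p => g p.1 p.2 = true)).card : ℝ) / (Fintype.card (Λ × Λ) : ℝ)|

/-- Discrepancy of `g`: the maximum over all combinatorial rectangles. -/
noncomputable def disc {Λ : Type*} [Fintype Λ] (g : Λ → Λ → Bool) : ℝ :=
  ⨆ R : Finset Λ × Finset Λ, rectDisc g R.1 R.2

/-- Min-entropy of the random variable `X` on `(Ω, μ)`: the largest `k` with
`Pr[X = x] ≤ 2^(-k)` for every value `x`. -/
noncomputable def minEntropy {Ω α : Type*} [MeasurableSpace Ω] (μ : Measure Ω) (X : Ω → α) : ℝ :=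
  sSup {k : ℝ | ∀ x : α, μ.real (X ⁻¹' {x}) ≤ (2 : ℝ) ^ (-k)}

/-- The projection `X_I` of a random string to the coordinates in `I`. -/
def proj {Ω ι Λ : Type*} (X : Ω → ι → Λ) (I : Finset ι) : Ω → I → Λ :=
  fun ω i => X ω i

/-- `X` is `δ`-dense: `H_∞(X_I) ≥ δ · b · |I|` for every set `I` of coordinates. -/
def IsDense {Ω ι : Type*} [MeasurableSpace Ω] {b : ℕ} (μ : Measure Ω)
    (X : Ω → ι → Block b) (δ : ℝ) : Prop :=
  ∀ I : Finset ι, δ * (b : ℝ) * (I.card : ℝ) ≤ minEntropy μ (proj X I)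

/-- Restrictions: strings in `{0,1,*}^n`, with `none` standing for `*`. -/
abbrev Restriction (n : ℕ) : Type := Fin n → Option Bool

/-- The free coordinates of a restriction. -/
def Restriction.free {n : ℕ} (ρ : Restriction n) : Finset (Fin n) :=
  Finset.univ.filter (fun i => ρ i = none)

/-- The fixed coordinates of a restriction. -/
def Restriction.fix {n : ℕ} (ρ : Restriction n) : Finset (Fin n) :=
  Finset.univ.filter (fun i => ρ i ≠ none)

/-- `z` agrees with `ρ` on the fixed coordinates. -/
def Restriction.Consistent {n : ℕ} (ρ : Restriction n) (z : Fin n → Bool) : Prop :=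
  ∀ i ∈ ρ.fix, some (z i) = ρ i

/-- The independent random variables `X, Y` are `(ρ, τ)`-structured with respect to `g`. -/
def IsStructured {Ω : Type*} [MeasurableSpace Ω] {b n : ℕ} (μ : Measure Ω)
    (g : Block b → Block b → Bool) (X Y : Ω → Fin n → Block b)
    (ρ : Restriction n) (τ : ℝ) : Prop :=
  0 < τ ∧ IndepFun X Y μ ∧
    (∃ δX δY : ℝ, 0 < δX ∧ 0 < δY ∧
      IsDense μ (proj X ρ.free) δX ∧ IsDense μ (proj Y ρ.free) δY ∧ τ ≤ δX + δY) ∧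
    ∀ᵐ ω ∂μ, ∀ i : ρ.fix, some (blockwise g (proj X ρ.fix ω) (proj Y ρ.fix ω) i) = ρ i

/-- Statistical (total variation) distance of two distributions on a finite space:
the maximum over events `E` of `|μ₁(E) - μ₂(E)|`. -/
noncomputable def statDist {α : Type*} [MeasurableSpace α] (μ₁ μ₂ : Measure α) : ℝ :=
  ⨆ E : Set α, |μ₁.real E - μ₂.real E|

/-- `μ₁` and `μ₂` are `ε`-close. -/
def IsClose {α : Type*} [MeasurableSpace α] (ε : ℝ) (μ₁ μ₂ : Measure α) : Prop :=
  statDist μ₁ μ₂ ≤ ε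

/-- The set `G⁻¹(z) ∩ (𝒳 × 𝒴)`, where `G = g^n`. -/
def fiber {b n : ℕ} (g : Block b → Block b → Bool) (z : Fin n → Bool)
    (𝒳 𝒴 : Set (Fin n → Block b)) : Set ((Fin n → Block b) × (Fin n → Block b)) :=
  {p | blockwise g p.1 p.2 = z} ∩ 𝒳 ×ˢ 𝒴

end Lifting

/-! On the fixed coordinates every pair of `𝒳 × 𝒴` already agrees with `z`, so only the free set `J`
matters. There, `2 ^ |J|` times the indicator of the fiber expands as the sum over `I ⊆ J` of the
characters `∏ i ∈ I, sgn (z i) * sgn (g (x i) (y i))`. The term `I = ∅` is the expected count `|A|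
|B|` on a subrectangle `A × B`; every other term has to be small.

Smallness is an XOR lemma for discrepancy with a multiplicative constant: if all rectangle sums of
the sign matrix are at most `D`, the sums of its `k`-th tensor power against bounded weights are at
most `(784 D) ^ k` times the bounds (`abs_sum_prod_sgn_le`). Rectangle sums do not tensor well,
operator norms do. `grothendieck` passes from rectangle sums to vector-valued sums, and Hahn–Banach
duality (`VectorBound.exists_weightedBound`) turns these into an operator norm bound between
weighted `ℓ²` spaces, which is multiplicative under tensor products (`WeightedBound.tensor`).

Density bounds the fibers of the projections to `I`, so each term is at most `q ^ |I| |𝒳| |𝒴|` with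
`q ≤ 784 * 2 ^ (-γ b) / n ^ 14`, and the total error `(1 + q) ^ |J| - 1` is at most `2 ^ (-γ b) / 4`
(`abs_two_pow_mul_card_sub_le`, `excess_bound`). Comparing the counts on `A × 𝒴` and on `𝒳 × 𝒴`
gives the marginal of `X`; `Y` is symmetric. -/

namespace Lifting

/-! ### From rectangle sums to sums against bounded functions. -/

section Grothendieck

/-- The sign `±1` encoded by a bit. -/
def sgn (e : Bool) : ℝ := if e then -1 else 1

lemma sgn_mul_self (e : Bool) : sgn e * sgn e = 1 := by cases e <;> simp [sgn]

lemma sgn_not (e : Bool) : sgn (!e) = -sgn e := by cases e <;> simp [sgn]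

lemma abs_sgn (e : Bool) : |sgn e| = 1 := by cases e <;> simp [sgn]

/-- The worst weight is the sign of `c`; splitting by that sign leaves two subset sums, hence the
factor 2. Using this in each variable gives the factor 4 in `bilin_le_of_rect_le`. -/
lemma abs_sum_mul_le_of_abs_sum_le {α : Type*} [Fintype α] {c a : α → ℝ} {D : ℝ}
    (hc : ∀ A : Finset α, |∑ x ∈ A, c x| ≤ D) (ha : ∀ x, |a x| ≤ 1) :
    |∑ x, a x * c x| ≤ 2 * D := by
  classical
  have h1 : |∑ x, a x * c x| ≤ ∑ x, |c x| := by
    refine (Finset.abs_sum_le_sum_abs _ _).trans (Finset.sum_le_sum fun x _ => ?_)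
    rw [abs_mul]
    exact mul_le_of_le_one_left (abs_nonneg _) (ha x)
  have h2 : ∑ x, |c x| = ∑ x ∈ Finset.univ.filter (fun x => 0 ≤ c x), c x
      - ∑ x ∈ Finset.univ.filter (fun x => ¬ 0 ≤ c x), c x := by
    rw [← Finset.sum_filter_add_sum_filter_not Finset.univ (fun x => 0 ≤ c x), sub_eq_add_neg,
      ← Finset.sum_neg_distrib]
    congr 1
    · exact Finset.sum_congr rfl fun x hx => abs_of_nonneg (Finset.mem_filter.1 hx).2
    · exact Finset.sum_congr rfl fun x hx =>
        abs_of_neg (not_le.1 (Finset.mem_filter.1 hx).2)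
  have h3 := (abs_le.1 (hc (Finset.univ.filter (fun x => 0 ≤ c x)))).2
  have h4 := (abs_le.1 (hc (Finset.univ.filter (fun x => ¬ 0 ≤ c x)))).1
  linarith

variable {α β : Type*} [Fintype α] [Fintype β]

lemma bilin_le_of_rect_le {M : α → β → ℝ} {D : ℝ}
    (hM : ∀ (A : Finset α) (B : Finset β), |∑ x ∈ A, ∑ y ∈ B, M x y| ≤ D)
    {a : α → ℝ} {b : β → ℝ} (ha : ∀ x, |a x| ≤ 1) (hb : ∀ y, |b y| ≤ 1) :
    ∑ x, ∑ y, M x y * (a x * b y) ≤ 4 * D := by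
  have h1 : ∀ B : Finset β, |∑ y ∈ B, ∑ x, a x * M x y| ≤ 2 * D := by
    intro B
    have := abs_sum_mul_le_of_abs_sum_le (c := fun x => ∑ y ∈ B, M x y) (fun A => hM A B) ha
    simp_rw [Finset.mul_sum] at this
    rwa [Finset.sum_comm]
  have h2 := (abs_le.1 (abs_sum_mul_le_of_abs_sum_le h1 hb)).2
  rw [Finset.sum_comm]
  calc _ = ∑ y, b y * ∑ x, a x * M x y := by
        refine Finset.sum_congr rfl fun y _ => ?_
        rw [Finset.mul_sum]
        exact Finset.sum_congr rfl fun x _ => by ring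
    _ ≤ 4 * D := by linarith

omit [Fintype α] in
lemma abs_div_le_one {a : α → ℝ} {A : ℝ} (hA : 0 ≤ A) (ha : ∀ x, |a x| ≤ A) :
    (∀ x, |a x / A| ≤ 1) ∧ ∀ x, a x = A * (a x / A) := by
  rcases hA.eq_or_lt with rfl | hA
  · exact ⟨by simp, fun x => by simpa using ha x⟩
  · refine ⟨fun x => ?_, fun x => by field_simp⟩
    rw [abs_div, abs_of_pos hA]
    exact (div_le_one hA).2 (ha x)

lemma bilin_le_mul {M : α → β → ℝ} {D : ℝ}
    (hD : ∀ (a : α → ℝ) (b : β → ℝ), (∀ x, |a x| ≤ 1) → (∀ y, |b y| ≤ 1) →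
      ∑ x, ∑ y, M x y * (a x * b y) ≤ D)
    {a : α → ℝ} {b : β → ℝ} {A B : ℝ} (hA : 0 ≤ A) (hB : 0 ≤ B)
    (ha : ∀ x, |a x| ≤ A) (hb : ∀ y, |b y| ≤ B) :
    ∑ x, ∑ y, M x y * (a x * b y) ≤ D * (A * B) := by
  obtain ⟨ha1, ha2⟩ := abs_div_le_one hA ha
  obtain ⟨hb1, hb2⟩ := abs_div_le_one hB hb
  have := mul_le_mul_of_nonneg_left (hD _ _ ha1 hb1) (mul_nonneg hA hB)
  calc _ = A * B * ∑ x, ∑ y, M x y * (a x / A * (b y / B)) := by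
        simp_rw [Finset.mul_sum]
        refine Finset.sum_congr rfl fun x _ => Finset.sum_congr rfl fun y _ => ?_
        conv_lhs => rw [ha2 x, hb2 y]
        ring
    _ ≤ _ := by linarith

/-! ### Second and fourth moments of Rademacher sums. -/

section Rademacher

variable {ι : Type*} [Fintype ι] [DecidableEq ι]

/-- The Rademacher sum `∑ u i ε i` at the sign pattern `σ`. -/
noncomputable def radSum (u : ι → ℝ) (s : Finset ι) (σ : ι → Bool) : ℝ := ∑ i ∈ s, u i * sgn (σ i)

lemma sum_mul_sgn_eq_zero (i : ι) (f : (ι → Bool) → ℝ)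
    (hf : ∀ σ, f (Function.update σ i (!σ i)) = f σ) :
    ∑ σ, f σ * sgn (σ i) = 0 := by
  refine Finset.sum_involution (fun σ _ => Function.update σ i (!σ i)) ?_ ?_ ?_ ?_
  · intro σ _
    rw [hf, Function.update_self, sgn_not]; ring
  · intro σ _ _ h
    have := congrFun h i
    simp at this
  · simp
  · intro σ _
    simp

omit [Fintype ι] in
lemma radSum_update {u : ι → ℝ} {s : Finset ι} {i : ι} (hi : i ∉ s) (σ : ι → Bool) (e : Bool) :
    radSum u s (Function.update σ i e) = radSum u s σ := by
  refine Finset.sum_congr rfl fun j hj => ?_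
  rw [Function.update_of_ne (by rintro rfl; exact hi hj)]

lemma sum_radSum_mul (u v : ι → ℝ) (s : Finset ι) :
    ∑ σ, radSum u s σ * radSum v s σ = Fintype.card (ι → Bool) * ∑ i ∈ s, u i * v i := by
  induction s using Finset.induction_on with
  | empty => simp [radSum]
  | insert i s hi ih =>
    have e : ∀ σ, radSum u (insert i s) σ * radSum v (insert i s) σ
        = radSum u s σ * radSum v s σ
          + (u i * radSum v s σ + v i * radSum u s σ) * sgn (σ i) + u i * v i := by
      intro σ
      simp only [radSum, Finset.sum_insert hi]
      linear_combination (u i * v i) * sgn_mul_self (σ i)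
    simp_rw [e]
    rw [Finset.sum_add_distrib, Finset.sum_add_distrib, ih, sum_mul_sgn_eq_zero,
      Finset.sum_insert hi]
    · simp; ring
    · intro σ; rw [radSum_update hi, radSum_update hi]

/-- When a coordinate is added, the odd powers of the new sign cancel, and what remains is dominated
by the expansion of `3 (P + u²)²`, with `P` the sum of the earlier squares. -/
lemma sum_radSum_pow_four (u : ι → ℝ) (s : Finset ι) :
    ∑ σ, radSum u s σ ^ 4 ≤ 3 * Fintype.card (ι → Bool) * (∑ i ∈ s, u i ^ 2) ^ 2 := by
  induction s using Finset.induction_on with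
  | empty => simp [radSum]
  | insert i s hi ih =>
    have e : ∀ σ, radSum u (insert i s) σ ^ 4 = radSum u s σ ^ 4
        + (4 * u i * radSum u s σ ^ 3 + 4 * u i ^ 3 * radSum u s σ) * sgn (σ i)
        + 6 * u i ^ 2 * (radSum u s σ * radSum u s σ) + u i ^ 4 := by
      intro σ
      have := sgn_mul_self (σ i)
      simp only [radSum, Finset.sum_insert hi]
      generalize ∑ i ∈ s, u i * sgn (σ i) = S
      generalize sgn (σ i) = t at *
      have t2 : t ^ 2 = 1 := by rw [sq]; exact this
      have t3 : t ^ 3 = t := by rw [pow_succ, t2, one_mul]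
      have t4 : t ^ 4 = 1 := by rw [show 4 = 2 * 2 from rfl, pow_mul, t2]; norm_num
      ring_nf
      rw [t2, t3, t4]; ring
    simp_rw [e]
    rw [Finset.sum_add_distrib, Finset.sum_add_distrib, Finset.sum_add_distrib,
      sum_mul_sgn_eq_zero, ← Finset.mul_sum, sum_radSum_mul, Finset.sum_insert hi]
    · simp only [Finset.sum_const, Finset.card_univ, nsmul_eq_mul]
      have h : ∑ i ∈ s, u i * u i = ∑ i ∈ s, u i ^ 2 :=
        Finset.sum_congr rfl fun _ _ => (sq _).symm
      rw [h]
      have hN : (0 : ℝ) ≤ (Fintype.card (ι → Bool) : ℝ) * u i ^ 4 := by positivity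
      nlinarith
    · intro σ; rw [radSum_update hi]

end Rademacher

/-! ### Grothendieck's inequality by truncating Rademacher sums. -/

/-- Every vector-valued evaluation of the matrix `M` is at most `C`. -/
def VectorBound (M : α → β → ℝ) (C : ℝ) : Prop :=
  ∀ (ι : Type) [Fintype ι] (u : α → ι → ℝ) (v : β → ι → ℝ) (A B : ℝ), 0 ≤ A → 0 ≤ B →
    (∀ x, ∑ i, u x i ^ 2 ≤ A ^ 2) → (∀ y, ∑ i, v y i ^ 2 ≤ B ^ 2) →
    ∑ x, ∑ y, M x y * ∑ i, u x i * v y i ≤ C * (A * B)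

/-- The part of `s` below the threshold `7 A`. -/
noncomputable def trunc (A s : ℝ) : ℝ := if |s| ≤ 7 * A then s else 0

lemma abs_trunc_le {A : ℝ} (hA : 0 ≤ A) (s : ℝ) : |trunc A s| ≤ 7 * A := by
  unfold trunc; split_ifs with h
  · exact h
  · simp; exact hA

lemma trunc_sq_le (A s : ℝ) : trunc A s ^ 2 ≤ s * s := by
  unfold trunc; split_ifs
  · rw [sq]
  · simpa using mul_self_nonneg s

lemma tail_sq_mul_le {A : ℝ} (hA : 0 ≤ A) (s : ℝ) :
    (s - trunc A s) ^ 2 * (49 * A ^ 2) ≤ s ^ 4 := by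
  unfold trunc; split_ifs with h
  · simp; positivity
  · have h1 : (7 * A) ^ 2 ≤ s ^ 2 := by
      rw [← sq_abs s]; exact pow_le_pow_left₀ (by positivity) (not_le.1 h).le 2
    nlinarith [mul_le_mul_of_nonneg_left h1 (sq_nonneg s)]

lemma sum_trunc_sq_le {ι : Type*} [Fintype ι] [DecidableEq ι] {u : ι → ℝ} {A : ℝ}
    (hu : ∑ i, u i ^ 2 ≤ A ^ 2) :
    ∑ σ, trunc A (radSum u Finset.univ σ) ^ 2
      ≤ (√(Fintype.card (ι → Bool)) * A) ^ 2 := by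
  rw [mul_pow, Real.sq_sqrt (Nat.cast_nonneg _)]
  refine (Finset.sum_le_sum fun σ _ => trunc_sq_le _ _).trans ?_
  rw [sum_radSum_mul]
  refine mul_le_mul_of_nonneg_left ?_ (Nat.cast_nonneg _)
  simpa only [sq] using hu

lemma sum_radSum_sq_le {ι : Type*} [Fintype ι] [DecidableEq ι] {u : ι → ℝ} {A : ℝ}
    (hu : ∑ i, u i ^ 2 ≤ A ^ 2) :
    ∑ σ, radSum u Finset.univ σ ^ 2
      ≤ (√(Fintype.card (ι → Bool)) * A) ^ 2 := by
  rw [mul_pow, Real.sq_sqrt (Nat.cast_nonneg _)]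
  simp_rw [sq (radSum _ _ _)]
  rw [sum_radSum_mul]
  refine mul_le_mul_of_nonneg_left ?_ (Nat.cast_nonneg _)
  simpa only [sq] using hu

/-- The fourth moment bounds the mean square of the tail by `3 A² / 49 ≤ (A / 4)²`; the threshold `7
A` is large enough for this. -/
lemma sum_tail_sq_le {ι : Type*} [Fintype ι] [DecidableEq ι] {u : ι → ℝ} {A : ℝ} (hA : 0 ≤ A)
    (hu : ∑ i, u i ^ 2 ≤ A ^ 2) :
    ∑ σ, (radSum u Finset.univ σ - trunc A (radSum u Finset.univ σ)) ^ 2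
      ≤ (√(Fintype.card (ι → Bool)) * (A / 4)) ^ 2 := by
  rw [mul_pow, Real.sq_sqrt (Nat.cast_nonneg _)]
  rcases hA.eq_or_lt with rfl | hA
  · have h0 : ∀ i, u i = 0 := by
      intro i
      have := (Finset.single_le_sum (fun j _ => sq_nonneg (u j)) (Finset.mem_univ i)).trans hu
      have h := le_antisymm (by simpa using this) (sq_nonneg (u i))
      exact pow_eq_zero_iff (two_ne_zero) |>.1 h
    simp [radSum, h0, trunc]
  · have h1 := Finset.sum_le_sum fun σ (_ : σ ∈ Finset.univ) =>
      tail_sq_mul_le hA.le (radSum u Finset.univ σ)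
    rw [← Finset.sum_mul] at h1
    have h2 := h1.trans (sum_radSum_pow_four u Finset.univ)
    have h3 : (∑ i, u i ^ 2) ^ 2 ≤ (A ^ 2) ^ 2 :=
      pow_le_pow_left₀ (Finset.sum_nonneg fun _ _ => sq_nonneg _) hu 2
    have hN : (0 : ℝ) ≤ Fintype.card (ι → Bool) := Nat.cast_nonneg _
    have hA2 : 0 < A ^ 2 := by positivity
    have h4 := h2.trans (mul_le_mul_of_nonneg_left h3 (by positivity))
    refine le_of_mul_le_mul_right (h4.trans ?_) (show 0 < 49 * A ^ 2 by positivity)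
    have : (0 : ℝ) ≤ Fintype.card (ι → Bool) * (A ^ 2 * A ^ 2) := by positivity
    nlinarith

/-- The inner product of `u` and `v` is the mean of the product of their Rademacher sums `S T`.
Write `S T = trunc S * trunc T + trunc S * tail T + tail S * T`. The first product is bounded
pointwise and costs `49 D`; the other two fall under the old bound with a factor `1 / 4` each. -/
lemma VectorBound.improve {M : α → β → ℝ} {D C : ℝ}
    (hD : ∀ (a : α → ℝ) (b : β → ℝ), (∀ x, |a x| ≤ 1) → (∀ y, |b y| ≤ 1) →
      ∑ x, ∑ y, M x y * (a x * b y) ≤ D) (hC : VectorBound M C) :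
    VectorBound M (49 * D + C / 2) := by
  classical
  intro ι _ u v A B hA hB hu hv
  set N : ℝ := ((Fintype.card (ι → Bool) : ℕ) : ℝ) with hN
  have hNpos : 0 < N := by rw [hN]; exact_mod_cast Fintype.card_pos
  set S : α → (ι → Bool) → ℝ := fun x => radSum (u x) Finset.univ with hS
  set T : β → (ι → Bool) → ℝ := fun y => radSum (v y) Finset.univ with hT
  have h1 : ∑ σ, ∑ x, ∑ y, M x y * (trunc A (S x σ) * trunc B (T y σ))
      ≤ N * (D * (7 * A * (7 * B))) := by
    refine (Finset.sum_le_sum fun σ _ => bilin_le_mul hD (by positivity) (by positivity)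
      (fun x => abs_trunc_le hA (S x σ)) (fun y => abs_trunc_le hB (T y σ))).trans ?_
    simp [hN]
  have h2 := hC (ι → Bool) (fun x σ => trunc A (S x σ)) (fun y σ => T y σ - trunc B (T y σ))
    (√N * A) (√N * (B / 4)) (by positivity) (by positivity)
    (fun x => sum_trunc_sq_le (hu x)) (fun y => sum_tail_sq_le hB (hv y))
  have h3 := hC (ι → Bool) (fun x σ => S x σ - trunc A (S x σ)) (fun y σ => T y σ)
    (√N * (A / 4)) (√N * B) (by positivity) (by positivity)
    (fun x => sum_tail_sq_le hA (hu x)) (fun y => sum_radSum_sq_le (hv y))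
  have h4 : N * ∑ x, ∑ y, M x y * ∑ i, u x i * v y i
      = ∑ σ, ∑ x, ∑ y, M x y * (trunc A (S x σ) * trunc B (T y σ))
        + ∑ x, ∑ y, M x y * ∑ σ, trunc A (S x σ) * (T y σ - trunc B (T y σ))
        + ∑ x, ∑ y, M x y * ∑ σ, (S x σ - trunc A (S x σ)) * T y σ := by
    have hcomm : ∀ F : (ι → Bool) → α → β → ℝ,
        ∑ σ, ∑ x, ∑ y, F σ x y = ∑ x, ∑ y, ∑ σ, F σ x y := fun F => by
      rw [Finset.sum_comm]
      exact Finset.sum_congr rfl fun x _ => Finset.sum_comm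
    rw [hcomm, ← Finset.sum_add_distrib, ← Finset.sum_add_distrib, Finset.mul_sum]
    refine Finset.sum_congr rfl fun x _ => ?_
    rw [← Finset.sum_add_distrib, ← Finset.sum_add_distrib, Finset.mul_sum]
    refine Finset.sum_congr rfl fun y _ => ?_
    rw [← Finset.mul_sum, ← mul_add, ← mul_add, ← Finset.sum_add_distrib,
      ← Finset.sum_add_distrib, mul_left_comm]
    congr 1
    rw [← sum_radSum_mul]
    exact Finset.sum_congr rfl fun σ _ => by simp only [hS, hT]; ring
  have hs : √N * √N = N := Real.mul_self_sqrt hNpos.le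
  refine le_of_mul_le_mul_left ?_ hNpos
  rw [h4]
  have h5 : C * (√N * A * (√N * (B / 4))) = N * (C * (A * B) / 4) := by
    linear_combination (C * A * B / 4) * hs
  have h6 : C * (√N * (A / 4) * (√N * B)) = N * (C * (A * B) / 4) := by
    linear_combination (C * A * B / 4) * hs
  rw [h5] at h2
  rw [h6] at h3
  linarith

lemma exists_vectorBound (M : α → β → ℝ) : VectorBound M (∑ x, ∑ y, |M x y|) := by
  intro ι _ u v A B hA hB hu hv
  rw [Finset.sum_mul]
  refine Finset.sum_le_sum fun x _ => ?_
  rw [Finset.sum_mul]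
  refine Finset.sum_le_sum fun y _ => ?_
  refine (le_abs_self _).trans ?_
  rw [abs_mul]
  refine mul_le_mul_of_nonneg_left ?_ (abs_nonneg _)
  refine abs_le_of_sq_le_sq ?_ (by positivity)
  rw [mul_pow]
  refine (Finset.sum_mul_sq_le_sq_mul_sq _ _ _).trans ?_
  exact mul_le_mul (hu x) (hv y) (Finset.sum_nonneg fun _ _ => sq_nonneg _) (sq_nonneg _)

/-- **Grothendieck's inequality** for finite real matrices. -/
theorem grothendieck {M : α → β → ℝ} {D : ℝ}
    (hD : ∀ (a : α → ℝ) (b : β → ℝ), (∀ x, |a x| ≤ 1) → (∀ y, |b y| ≤ 1) →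
      ∑ x, ∑ y, M x y * (a x * b y) ≤ D) :
    VectorBound M (98 * D) := by
  have hD0 : 0 ≤ D := by simpa using hD 0 0 (by simp) (by simp)
  -- `98 D` is the fixed point of `C ↦ 49 D + C / 2`; starting from the trivial bound, the excess
  -- halves at every step.
  have hiter : ∀ k : ℕ, VectorBound M (98 * D + (∑ x, ∑ y, |M x y|) * (1 / 2) ^ k) := by
    intro k
    induction k with
    | zero =>
      intro ι _ u v A B hA hB hu hv
      refine (exists_vectorBound M ι u v A B hA hB hu hv).trans ?_
      refine mul_le_mul_of_nonneg_right ?_ (mul_nonneg hA hB)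
      simp; exact hD0
    | succ k ih =>
      convert ih.improve hD using 1
      rw [pow_succ]; ring
  intro ι _ u v A B hA hB hu hv
  have hlim : Filter.Tendsto
      (fun k : ℕ => (98 * D + (∑ x, ∑ y, |M x y|) * (1 / 2 : ℝ) ^ k) * (A * B)) Filter.atTop
      (nhds ((98 * D + (∑ x, ∑ y, |M x y|) * 0) * (A * B))) :=
    ((tendsto_const_nhds.add ((tendsto_pow_atTop_nhds_zero_of_lt_one (by norm_num)
      (by norm_num)).const_mul _)).mul_const _)
  rw [mul_zero, add_zero] at hlim
  exact ge_of_tendsto' hlim fun k => hiter k ι u v A B hA hB hu hv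

end Grothendieck

end Lifting

namespace Lifting

/-! ### Duality: from vector bounds to weighted `ℓ²` operator bounds. -/

section Factorization

variable {α β : Type*} [Fintype α] [Fintype β]

/-- The slack vectors of the quadratic form of `M` at vector-valued arguments. -/
def slackCone (M : α → β → ℝ) (L : ℝ) : Set (α × β → ℝ) :=
  {t | ∃ (ι : Type) (_ : Fintype ι) (u : α → ι → ℝ) (v : β → ι → ℝ), ∀ z, t z =
    L / 2 * (∑ i, u z.1 i ^ 2 + ∑ i, v z.2 i ^ 2) - ∑ x, ∑ y, M x y * ∑ i, u x i * v y i}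

/-- Vectors scaled by `√a` and `√b` and placed in orthogonal summands realise the convex
combination. Convexity is the reason for allowing index types of arbitrary finite size. -/
lemma convex_slackCone (M : α → β → ℝ) (L : ℝ) : Convex ℝ (slackCone M L) := by
  rintro s ⟨ι, _, u, v, hs⟩ t ⟨κ, _, u', v', ht⟩ a b ha hb -
  refine ⟨ι ⊕ κ, inferInstance, fun x => Sum.elim (fun i => √a * u x i) (fun j => √b * u' x j),
    fun x => Sum.elim (fun i => √a * v x i) (fun j => √b * v' x j), fun z => ?_⟩
  have e1 : ∀ w w' : ℝ, √a * w * (√a * w') = a * (w * w') := fun w w' => by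
    linear_combination (w * w') * Real.mul_self_sqrt ha
  have e2 : ∀ w w' : ℝ, √b * w * (√b * w') = b * (w * w') := fun w w' => by
    linear_combination (w * w') * Real.mul_self_sqrt hb
  simp only [Pi.add_apply, Pi.smul_apply, smul_eq_mul, hs, ht, Fintype.sum_sum_type, Sum.elim_inl,
    Sum.elim_inr, mul_pow, Real.sq_sqrt ha, Real.sq_sqrt hb, e1, e2, ← Finset.mul_sum]
  have e3 : ∀ (P Q : α → β → ℝ), ∑ x, ∑ y, M x y * (a * P x y + b * Q x y)
      = a * ∑ x, ∑ y, M x y * P x y + b * ∑ x, ∑ y, M x y * Q x y := by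
    intro P Q
    simp_rw [Finset.mul_sum, ← Finset.sum_add_distrib]
    exact Finset.sum_congr rfl fun x _ => Finset.sum_congr rfl fun y _ => by ring
  rw [e3]; ring

/-- At the pair of longest vectors, AM-GM bounds the product of the two norms in `VectorBound` by
half the sum of their squares. -/
lemma VectorBound.exists_nonneg_slack [Nonempty α] [Nonempty β] {M : α → β → ℝ} {L : ℝ}
    (hM : VectorBound M L) (hL : 0 ≤ L) {t : α × β → ℝ} (ht : t ∈ slackCone M L) :
    ∃ z, 0 ≤ t z := by
  obtain ⟨ι, _, u, v, ht⟩ := ht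
  obtain ⟨x, hx⟩ := Finite.exists_max fun x => ∑ i, u x i ^ 2
  obtain ⟨y, hy⟩ := Finite.exists_max fun y => ∑ i, v y i ^ 2
  refine ⟨(x, y), ?_⟩
  have hA : 0 ≤ ∑ i, u x i ^ 2 := Finset.sum_nonneg fun _ _ => sq_nonneg _
  have hB : 0 ≤ ∑ i, v y i ^ 2 := Finset.sum_nonneg fun _ _ => sq_nonneg _
  have h := hM ι u v (√(∑ i, u x i ^ 2)) (√(∑ i, v y i ^ 2)) (Real.sqrt_nonneg _)
    (Real.sqrt_nonneg _) (by rw [Real.sq_sqrt hA]; exact hx) (by rw [Real.sq_sqrt hB]; exact hy)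
  rw [ht, sub_nonneg]
  refine h.trans ?_
  have := two_mul_le_add_sq (√(∑ i, u x i ^ 2)) (√(∑ i, v y i ^ 2))
  rw [Real.sq_sqrt hA, Real.sq_sqrt hB] at this
  nlinarith

/-- The convex set of slack vectors misses the open negative orthant, and a separating functional
provides the weights. -/
lemma VectorBound.exists_joint_weight [Nonempty α] [Nonempty β] {M : α → β → ℝ} {L : ℝ}
    (hM : VectorBound M L) (hL : 0 ≤ L) :
    ∃ w : α × β → ℝ, (∀ z, 0 ≤ w z) ∧ 0 < ∑ z, w z ∧
      ∀ t ∈ slackCone M L, 0 ≤ ∑ z, w z * t z := by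
  classical
  have hopen : IsOpen {t : α × β → ℝ | ∀ z, t z < 0} := by
    simp only [Set.ofPred_forall]
    exact isOpen_iInter_of_finite fun z => isOpen_lt (continuous_apply z) continuous_const
  have hconv : Convex ℝ {t : α × β → ℝ | ∀ z, t z < 0} := by
    simp only [Set.ofPred_forall]
    exact convex_iInter fun z => convex_halfSpace_lt (LinearMap.proj z).isLinear 0
  have hdisj : Disjoint {t : α × β → ℝ | ∀ z, t z < 0} (slackCone M L) := by
    rw [Set.disjoint_left]
    intro t ht ht'
    obtain ⟨z, hz⟩ := hM.exists_nonneg_slack hL ht'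
    exact absurd (ht z) (not_lt.2 hz)
  obtain ⟨f, r, hf1, hf2⟩ :=
    geometric_hahn_banach_open hconv hopen (convex_slackCone M L) hdisj
  have hfw : ∀ t, f t = ∑ z, f (Pi.single z 1) * t z := by
    intro t
    conv_lhs => rw [pi_eq_sum_univ' t]
    rw [map_sum]
    refine Finset.sum_congr rfl fun z _ => ?_
    rw [map_smul, smul_eq_mul, mul_comm]
  -- The empty family of vectors puts `0` in the slack set.
  have hr0 : r ≤ 0 := by
    have := hf2 0 ⟨Empty, inferInstance, fun _ => Empty.elim, fun _ => Empty.elim, by simp⟩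
    simpa using this
  have hW : 0 < ∑ z, f (Pi.single z 1) := by
    have := hf1 (fun _ => -1) (fun _ => by norm_num)
    rw [hfw] at this
    simp at this
    linarith
  have hr : 0 ≤ r := by
    by_contra! hr
    have := hf1 (fun _ => r / ∑ z, f (Pi.single z 1)) (fun _ => div_neg_of_neg_of_pos hr hW)
    rw [hfw, ← Finset.sum_mul, mul_div_cancel₀ _ hW.ne'] at this
    exact lt_irrefl _ this
  refine ⟨fun z => f (Pi.single z 1), fun z => ?_, hW, fun t ht => ?_⟩
  · by_contra! hz
    set W := ∑ z, f (Pi.single z 1) with hWdef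
    -- If the weight at `z` were negative, this point of the negative orthant would have value
    -- exactly `0`, contradicting `r ≤ 0`.
    have := hf1 (fun i => -1 - (if i = z then W / -f (Pi.single z 1) else 0)) (fun i => by
      have : 0 < W / -f (Pi.single z 1) := div_pos hW (neg_pos.2 hz)
      dsimp only
      split_ifs <;> linarith)
    rw [hfw] at this
    simp only [mul_sub, Finset.sum_sub_distrib, mul_ite, mul_zero, Finset.sum_ite_eq',
      Finset.mem_univ, if_true, mul_neg, mul_one, Finset.sum_neg_distrib, ← hWdef] at this
    have e : f (Pi.single z 1) * (W / -f (Pi.single z 1)) = -W := by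
      rw [div_neg, mul_neg, mul_div_cancel₀ _ hz.ne]
    rw [e] at this
    linarith
  · rw [← hfw]
    exact hr.trans (hf2 t ht)

/-- A bilinear form on weighted `ℓ²` spaces, bounded in the form dual to
`(∑ M a b)² ≤ C (∑ p a²) (∑ q b²)`. -/
def WeightedBound (M : α → β → ℝ) (p : α → ℝ) (q : β → ℝ) (C : ℝ) : Prop :=
  ∀ a : α → ℝ, ∑ y, (∑ x, M x y * a x) ^ 2 / q y ≤ C * ∑ x, p x * a x ^ 2

lemma weightedBound_of_sq_le {M : α → β → ℝ} {p : α → ℝ} {q : β → ℝ} {C : ℝ} (hC : 0 ≤ C)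
    (hp : ∀ x, 0 ≤ p x) (hq : ∀ y, 0 < q y)
    (h : ∀ (a : α → ℝ) (b : β → ℝ), (∑ x, ∑ y, M x y * (a x * b y)) ^ 2
      ≤ C * (∑ x, p x * a x ^ 2) * (∑ y, q y * b y ^ 2)) : WeightedBound M p q C := by
  intro a
  have h1 := h a (fun y => (∑ x, M x y * a x) / q y)
  have e1 : ∑ x, ∑ y, M x y * (a x * ((∑ x, M x y * a x) / q y))
      = ∑ y, (∑ x, M x y * a x) ^ 2 / q y := by
    rw [Finset.sum_comm]
    refine Finset.sum_congr rfl fun y _ => ?_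
    rw [sq, mul_div_assoc, Finset.sum_mul]
    exact Finset.sum_congr rfl fun x _ => by ring
  have e2 : ∑ y, q y * ((∑ x, M x y * a x) / q y) ^ 2 = ∑ y, (∑ x, M x y * a x) ^ 2 / q y := by
    refine Finset.sum_congr rfl fun y _ => ?_
    have := (hq y).ne'
    field_simp
  rw [e1, e2, sq] at h1
  have h0 : 0 ≤ ∑ y, (∑ x, M x y * a x) ^ 2 / q y :=
    Finset.sum_nonneg fun y _ => div_nonneg (sq_nonneg _) (hq y).le
  rcases h0.eq_or_lt with h0 | h0
  · rw [← h0]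
    exact mul_nonneg hC (Finset.sum_nonneg fun x _ => mul_nonneg (hp x) (sq_nonneg _))
  · exact le_of_mul_le_mul_right h1 h0

/-- Averaging with the uniform distribution makes the weight positive at the price of a factor 2.
Positivity matters because `WeightedBound` divides by `q`. -/
lemma sum_weight_sq_le {γ : Type*} [Fintype γ] [Nonempty γ] {w : γ → ℝ} (hw : ∀ x, 0 ≤ w x)
    (hw1 : ∑ x, w x = 1) : ∃ p : γ → ℝ, (∀ x, 0 < p x) ∧ ∑ x, p x = 1 ∧
      ∀ a : γ → ℝ, ∑ x, w x * a x ^ 2 ≤ 2 * ∑ x, p x * a x ^ 2 := by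
  have hN : (0 : ℝ) < Fintype.card γ := by exact_mod_cast Fintype.card_pos
  refine ⟨fun x => (w x + 1 / Fintype.card γ) / 2, fun x => ?_, ?_, fun a => ?_⟩
  · have := hw x; positivity
  · rw [← Finset.sum_div, Finset.sum_add_distrib, hw1]
    simp [hN.ne']
  · rw [Finset.mul_sum]
    refine Finset.sum_le_sum fun x _ => ?_
    have : 0 ≤ 1 / (Fintype.card γ : ℝ) * a x ^ 2 := by positivity
    linarith

/-- The two marginals of the joint weight serve as `p` and `q`; scalar slack vectors give a bound by
the sum of the two quadratic forms. -/
theorem VectorBound.exists_weightedBound [Nonempty α] [Nonempty β] {M : α → β → ℝ} {L : ℝ}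
    (hM : VectorBound M L) (hL : 0 ≤ L) :
    ∃ (p : α → ℝ) (q : β → ℝ), (∀ x, 0 < p x) ∧ (∀ y, 0 < q y) ∧ ∑ x, p x = 1 ∧ ∑ y, q y = 1 ∧
      WeightedBound M p q ((2 * L) ^ 2) := by
  obtain ⟨w, hw, hW, hwt⟩ := hM.exists_joint_weight hL
  set W := ∑ z, w z with hWdef
  have hW' : ∑ x, ∑ y, w (x, y) = W := (Fintype.sum_prod_type _).symm
  obtain ⟨p, hp, hp1, hpa⟩ := sum_weight_sq_le (w := fun x => (∑ y, w (x, y)) / W)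
    (fun x => div_nonneg (Finset.sum_nonneg fun _ _ => hw _) hW.le)
    (by rw [← Finset.sum_div, hW', div_self hW.ne'])
  obtain ⟨q, hq, hq1, hqb⟩ := sum_weight_sq_le (w := fun y => (∑ x, w (x, y)) / W)
    (fun y => div_nonneg (Finset.sum_nonneg fun _ _ => hw _) hW.le)
    (by rw [← Finset.sum_div, Finset.sum_comm, hW', div_self hW.ne'])
  refine ⟨p, q, hp, hq, hp1, hq1,
    weightedBound_of_sq_le (by positivity) (fun x => (hp x).le) hq fun a b => ?_⟩
  have h1 : ∀ (a : α → ℝ) (b : β → ℝ), ∑ x, ∑ y, M x y * (a x * b y)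
      ≤ L * (∑ x, p x * a x ^ 2 + ∑ y, q y * b y ^ 2) := by
    intro a b
    have h := hwt _ ⟨Unit, inferInstance, fun x _ => a x, fun y _ => b y, fun z => rfl⟩
    simp only [Finset.univ_unique, Finset.sum_singleton, mul_sub, Finset.sum_sub_distrib,
      ← Finset.sum_mul, ← hWdef] at h
    have e : ∑ z : α × β, w z * (L / 2 * (a z.1 ^ 2 + b z.2 ^ 2))
        = W * (L / 2 * (∑ x, (∑ y, w (x, y)) / W * a x ^ 2
          + ∑ y, (∑ x, w (x, y)) / W * b y ^ 2)) := by
      have e1 : ∑ x, (∑ y, w (x, y)) / W * a x ^ 2 = (∑ x, ∑ y, w (x, y) * a x ^ 2) / W := by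
        rw [Finset.sum_div]
        refine Finset.sum_congr rfl fun x _ => ?_
        rw [← Finset.sum_mul]; ring
      have e2 : ∑ y, (∑ x, w (x, y)) / W * b y ^ 2 = (∑ x, ∑ y, w (x, y) * b y ^ 2) / W := by
        rw [Finset.sum_comm, Finset.sum_div]
        refine Finset.sum_congr rfl fun y _ => ?_
        rw [← Finset.sum_mul]; ring
      rw [e1, e2, Fintype.sum_prod_type, ← add_div, ← Finset.sum_add_distrib]
      simp_rw [← Finset.sum_add_distrib, ← mul_add]
      have e3 : ∀ x y, w (x, y) * (L / 2 * (a x ^ 2 + b y ^ 2))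
          = L / 2 * (w (x, y) * (a x ^ 2 + b y ^ 2)) := fun x y => by ring
      simp_rw [e3, ← Finset.mul_sum]
      field_simp
    rw [e, ← mul_sub] at h
    have h' := nonneg_of_mul_nonneg_right h hW
    have := mul_le_mul_of_nonneg_left (add_le_add (hpa a) (hqb b)) (show 0 ≤ L / 2 by positivity)
    linarith
  -- Rescaling `a` by `s` makes this quadratic nonnegative for all `s`; its discriminant converts
  -- the sum of the two forms into their product, with constant `4 L L = (2 L)²`.
  have h2 : ∀ s : ℝ, 0 ≤ L * (∑ x, p x * a x ^ 2) * (s * s)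
      + (-∑ x, ∑ y, M x y * (a x * b y)) * s + L * ∑ y, q y * b y ^ 2 := by
    intro s
    have h := h1 (fun x => s * a x) b
    have e1 : ∑ x, ∑ y, M x y * (s * a x * b y) = s * ∑ x, ∑ y, M x y * (a x * b y) := by
      simp_rw [Finset.mul_sum]
      exact Finset.sum_congr rfl fun x _ => Finset.sum_congr rfl fun y _ => by ring
    have e2 : ∑ x, p x * (s * a x) ^ 2 = s * s * ∑ x, p x * a x ^ 2 := by
      rw [Finset.mul_sum]
      exact Finset.sum_congr rfl fun x _ => by ring
    rw [e1, e2] at h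
    linarith
  have h3 := discrim_le_zero h2
  rw [discrim] at h3
  linarith

lemma WeightedBound.sum_le {M : α → β → ℝ} {p : α → ℝ} {q : β → ℝ} {K : ℝ}
    (h : WeightedBound M p q (K ^ 2)) (hK : 0 ≤ K) (hp : ∀ x, 0 ≤ p x) (hq : ∀ y, 0 < q y)
    (hp1 : ∑ x, p x = 1) (hq1 : ∑ y, q y = 1) {a : α → ℝ} {b : β → ℝ} {A B : ℝ}
    (hA : 0 ≤ A) (hB : 0 ≤ B) (ha : ∀ x, |a x| ≤ A) (hb : ∀ y, |b y| ≤ B) :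
    |∑ x, ∑ y, M x y * (a x * b y)| ≤ K * (A * B) := by
  refine abs_le_of_sq_le_sq ?_ (by positivity)
  have e1 : ∑ x, ∑ y, M x y * (a x * b y) = ∑ y, (∑ x, M x y * a x) * b y := by
    rw [Finset.sum_comm]
    refine Finset.sum_congr rfl fun y _ => ?_
    rw [Finset.sum_mul]
    exact Finset.sum_congr rfl fun x _ => by ring
  have h1 : (∑ y, (∑ x, M x y * a x) * b y) ^ 2
      ≤ (∑ y, (∑ x, M x y * a x) ^ 2 / q y) * ∑ y, q y * b y ^ 2 := by
    refine Finset.sum_sq_le_sum_mul_sum_of_sq_le_mul _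
      (fun y _ => div_nonneg (sq_nonneg _) (hq y).le)
      (fun y _ => mul_nonneg (hq y).le (sq_nonneg _)) fun y _ => le_of_eq ?_
    have := (hq y).ne'
    field_simp
  have h2 : ∑ y, q y * b y ^ 2 ≤ B ^ 2 := by
    calc _ ≤ ∑ y, q y * B ^ 2 := Finset.sum_le_sum fun y _ =>
          mul_le_mul_of_nonneg_left (sq_le_sq' (abs_le.1 (hb y)).1 (abs_le.1 (hb y)).2) (hq y).le
      _ = B ^ 2 := by rw [← Finset.sum_mul, hq1, one_mul]
  have h3 : ∑ x, p x * a x ^ 2 ≤ A ^ 2 := by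
    calc _ ≤ ∑ x, p x * A ^ 2 := Finset.sum_le_sum fun x _ =>
          mul_le_mul_of_nonneg_left (sq_le_sq' (abs_le.1 (ha x)).1 (abs_le.1 (ha x)).2) (hp x)
      _ = A ^ 2 := by rw [← Finset.sum_mul, hp1, one_mul]
  rw [e1]
  refine h1.trans ?_
  calc _ ≤ (K ^ 2 * A ^ 2) * B ^ 2 := mul_le_mul
        ((h a).trans (mul_le_mul_of_nonneg_left h3 (sq_nonneg K))) h2
        (Finset.sum_nonneg fun y _ => mul_nonneg (hq y).le (sq_nonneg _)) (by positivity)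
    _ = _ := by ring

/-- With the second argument eliminated, the bound is an operator norm, and `M ⊗ M'` acts as `M'` in
one variable followed by `M` in the other. -/
lemma WeightedBound.tensor {α' β' : Type*} [Fintype α'] [Fintype β'] {M : α → β → ℝ} {p : α → ℝ}
    {q : β → ℝ} {C : ℝ} {M' : α' → β' → ℝ} {p' : α' → ℝ} {q' : β' → ℝ} {C' : ℝ}
    (h : WeightedBound M p q C) (h' : WeightedBound M' p' q' C') (hC : 0 ≤ C)
    (hp : ∀ x, 0 ≤ p x) (hq' : ∀ y, 0 ≤ q' y) :
    WeightedBound (fun (x : α × α') (y : β × β') => M x.1 y.1 * M' x.2 y.2)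
      (fun x => p x.1 * p' x.2) (fun y => q y.1 * q' y.2) (C * C') := by
  intro a
  simp only [Fintype.sum_prod_type]
  set c : β' → α → ℝ := fun y' x => ∑ x', M' x' y' * a (x, x') with hc
  calc ∑ y, ∑ y', (∑ x, ∑ x', M x y * M' x' y' * a (x, x')) ^ 2 / (q y * q' y')
      = ∑ y', (∑ y, (∑ x, M x y * c y' x) ^ 2 / q y) / q' y' := by
        rw [Finset.sum_comm]
        refine Finset.sum_congr rfl fun y' _ => ?_
        rw [Finset.sum_div]
        refine Finset.sum_congr rfl fun y _ => ?_
        rw [div_div]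
        congr 2
        refine Finset.sum_congr rfl fun x _ => ?_
        rw [hc, Finset.mul_sum]
        exact Finset.sum_congr rfl fun x' _ => by ring
    _ ≤ ∑ y', (C * ∑ x, p x * c y' x ^ 2) / q' y' := Finset.sum_le_sum fun y' _ =>
        div_le_div_of_nonneg_right (h (c y')) (hq' y')
    _ = C * ∑ x, p x * ∑ y', c y' x ^ 2 / q' y' := by
        simp_rw [Finset.mul_sum, Finset.sum_div]
        rw [Finset.sum_comm]
        refine Finset.sum_congr rfl fun x _ => Finset.sum_congr rfl fun y' _ => by ring
    _ ≤ C * ∑ x, p x * (C' * ∑ x', p' x' * a (x, x') ^ 2) := by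
        refine mul_le_mul_of_nonneg_left (Finset.sum_le_sum fun x _ => ?_) hC
        exact mul_le_mul_of_nonneg_left (h' fun x' => a (x, x')) (hp x)
    _ = _ := by
        simp_rw [Finset.mul_sum]
        exact Finset.sum_congr rfl fun x _ => Finset.sum_congr rfl fun x' _ => by ring

lemma sum_fin_succ_pi {γ : Type*} [Fintype γ] {k : ℕ} (f : (Fin (k + 1) → γ) → ℝ) :
    ∑ w, f w = ∑ z : γ × (Fin k → γ), f (Fin.cons z.1 z.2) :=
  (Equiv.sum_comp (Fin.consEquiv fun _ => γ) f).symm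

lemma WeightedBound.pi {M : α → β → ℝ} {p : α → ℝ} {q : β → ℝ} {C : ℝ}
    (h : WeightedBound M p q C) (hC : 0 ≤ C) (hp : ∀ x, 0 ≤ p x) (hq : ∀ y, 0 ≤ q y) (k : ℕ) :
    WeightedBound (fun (x : Fin k → α) (y : Fin k → β) => ∏ i, M (x i) (y i))
      (fun x => ∏ i, p (x i)) (fun y => ∏ i, q (y i)) (C ^ k) := by
  induction k with
  | zero => intro a; simp
  | succ k ih =>
    intro a
    have := h.tensor ih hC hp (fun y => Finset.prod_nonneg fun i _ => hq (y i))
      (fun z => a (Fin.cons z.1 z.2))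
    simp only [sum_fin_succ_pi, Fin.prod_univ_succ, Fin.cons_zero, Fin.cons_succ]
    rw [pow_succ']
    exact this

end Factorization

end Lifting

namespace Lifting

/-! ### Character sums over product sets and the count of solutions. -/

section Counting

variable {Λ : Type*} [Fintype Λ]

/-- Bound for products of the sign matrix of a gadget with small rectangle sums. -/
lemma abs_sum_prod_sgn_le [Nonempty Λ] {g : Λ → Λ → Bool} {D : ℝ}
    (hg : ∀ A B : Finset Λ, |∑ x ∈ A, ∑ y ∈ B, sgn (g x y)| ≤ D) {k : ℕ}
    {a b : (Fin k → Λ) → ℝ} {A B : ℝ} (hA : 0 ≤ A) (hB : 0 ≤ B) (ha : ∀ x, |a x| ≤ A)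
    (hb : ∀ y, |b y| ≤ B) :
    |∑ x, ∑ y, (∏ i, sgn (g (x i) (y i))) * (a x * b y)| ≤ (784 * D) ^ k * (A * B) := by
  have hD : 0 ≤ D := by simpa using hg ∅ ∅
  obtain ⟨p, q, hp, hq, hp1, hq1, h⟩ :=
    (grothendieck (M := fun x y => sgn (g x y)) (D := 4 * D)
      fun a b ha hb => bilin_le_of_rect_le hg ha hb).exists_weightedBound (by positivity)
  have h' := h.pi (sq_nonneg _) (fun x => (hp x).le) (fun y => (hq y).le) k
  -- 784 collects 4 from rectangles to bounded functions, 98 from Grothendieck and 2 from duality.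
  rw [show 2 * (98 * (4 * D)) = 784 * D by ring, ← pow_mul, mul_comm 2 k, pow_mul] at h'
  refine h'.sum_le (by positivity) (fun x => Finset.prod_nonneg fun i _ => (hp _).le)
    (fun y => Finset.prod_pos fun i _ => hq _) ?_ ?_ hA hB ha hb
  · rw [← Fintype.sum_pow, hp1, one_pow]
  · rw [← Fintype.sum_pow, hq1, one_pow]

variable {ι : Type*} [DecidableEq Λ]

lemma sum_comp_eq_sum_card_mul {κ : Type*} [Fintype κ] [DecidableEq κ] (A : Finset (ι → Λ))
    (e : κ → ι) (F : (κ → Λ) → ℝ) :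
    ∑ x ∈ A, F (fun j => x (e j))
      = ∑ w, ((A.filter fun x => (fun j => x (e j)) = w).card : ℝ) * F w := by
  rw [← Finset.sum_fiberwise A (fun x j => x (e j))]
  refine Finset.sum_congr rfl fun w _ => ?_
  rw [Finset.sum_congr rfl (g := fun _ => F w) fun x hx => by rw [(Finset.mem_filter.1 hx).2]]
  simp

/-- The character depends only on the coordinates in `I`, so the sum is a bilinear form in the fiber
sizes of `A` and `B` over these coordinates. -/
lemma abs_sum_sum_prod_sgn_le [Nonempty Λ] {g : Λ → Λ → Bool} {D : ℝ}
    (hg : ∀ A B : Finset Λ, |∑ x ∈ A, ∑ y ∈ B, sgn (g x y)| ≤ D)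
    {A B : Finset (ι → Λ)} {I : Finset ι} {a b : ℝ} (ha0 : 0 ≤ a) (hb0 : 0 ≤ b)
    (ha : ∀ w : ι → Λ, ((A.filter fun x => ∀ i ∈ I, x i = w i).card : ℝ) ≤ a)
    (hb : ∀ w : ι → Λ, ((B.filter fun x => ∀ i ∈ I, x i = w i).card : ℝ) ≤ b) :
    |∑ x ∈ A, ∑ y ∈ B, ∏ i ∈ I, sgn (g (x i) (y i))| ≤ (784 * D) ^ I.card * (a * b) := by
  set e : Fin I.card → ι := fun j => (I.equivFin.symm j : ι) with he
  have hprod : ∀ f : ι → ℝ, ∏ i ∈ I, f i = ∏ j, f (e j) := fun f => by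
    rw [← Finset.prod_coe_sort, ← Equiv.prod_comp I.equivFin.symm]
  have hcard : ∀ (S : Finset (ι → Λ)) (s : ℝ), 0 ≤ s →
      (∀ w : ι → Λ, ((S.filter fun x => ∀ i ∈ I, x i = w i).card : ℝ) ≤ s) →
      ∀ w, |((S.filter fun x => (fun j => x (e j)) = w).card : ℝ)| ≤ s := by
    intro S s hs hS w
    rw [abs_of_nonneg (Nat.cast_nonneg _)]
    rcases Finset.eq_empty_or_nonempty (S.filter fun x => (fun j => x (e j)) = w) with h | ⟨w', h⟩
    · simpa [h] using hs
    · refine le_trans ?_ (hS w')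
      refine Nat.cast_le.2 (Finset.card_le_card fun x hx => ?_)
      rw [Finset.mem_filter] at hx h ⊢
      refine ⟨hx.1, fun i hi => ?_⟩
      have := congrFun (hx.2.trans h.2.symm) (I.equivFin ⟨i, hi⟩)
      simpa [he] using this
  have h := abs_sum_prod_sgn_le hg ha0 hb0 (hcard A a ha0 ha) (hcard B b hb0 hb)
  convert h using 2
  simp_rw [hprod]
  rw [sum_comp_eq_sum_card_mul A e fun w => ∑ y ∈ B, ∏ j, sgn (g (w j) (y (e j)))]
  refine Finset.sum_congr rfl fun w _ => ?_
  rw [sum_comp_eq_sum_card_mul B e fun w' => ∏ j, sgn (g (w j) (w' j)), Finset.mul_sum]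
  exact Finset.sum_congr rfl fun w' _ => by ring

-- Each condition `g = z` has indicator `(1 + sgn z * sgn g) / 2`; multiplying out over `J` gives
-- the sum over subsets.
omit [Fintype Λ] [DecidableEq Λ] in
omit [Fintype Λ] [DecidableEq Λ] in
omit [Fintype Λ] [DecidableEq Λ] in
lemma two_pow_mul_card_eq_sum [DecidableEq ι] (g : Λ → Λ → Bool) (z : ι → Bool)
    (A B : Finset (ι → Λ)) (J : Finset ι) :
    2 ^ J.card * (((A ×ˢ B).filter fun p => ∀ i ∈ J, g (p.1 i) (p.2 i) = z i).card : ℝ)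
      = ∑ I ∈ J.powerset, (∏ i ∈ I, sgn (z i)) *
          ∑ x ∈ A, ∑ y ∈ B, ∏ i ∈ I, sgn (g (x i) (y i)) := by
  have h1 : ∀ x y : ι → Λ, (if ∀ i ∈ J, g (x i) (y i) = z i then (2 : ℝ) ^ J.card else 0)
      = ∑ I ∈ J.powerset, (∏ i ∈ I, sgn (z i)) * ∏ i ∈ I, sgn (g (x i) (y i)) := by
    intro x y
    simp_rw [← Finset.prod_mul_distrib]
    rw [← Finset.prod_one_add, ← Finset.prod_const, ← Finset.prod_ite_zero]
    refine Finset.prod_congr rfl fun i _ => ?_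
    cases g (x i) (y i) <;> cases z i <;> simp [sgn] <;> norm_num
  have h2 : ∀ F : Finset ι → (ι → Λ) → (ι → Λ) → ℝ, ∑ I ∈ J.powerset, ∑ x ∈ A, ∑ y ∈ B, F I x y
      = ∑ x ∈ A, ∑ y ∈ B, ∑ I ∈ J.powerset, F I x y := fun F => by
    rw [Finset.sum_comm]
    exact Finset.sum_congr rfl fun x _ => Finset.sum_comm
  rw [Finset.card_filter, Nat.cast_sum, Finset.mul_sum, Finset.sum_product]
  simp_rw [Finset.mul_sum]
  rw [h2]
  refine Finset.sum_congr rfl fun x _ => Finset.sum_congr rfl fun y _ => ?_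
  rw [← h1]
  split_ifs <;> simp

/-- A number of solutions close to the expected one in every subrectangle. -/
theorem abs_two_pow_mul_card_sub_le [Nonempty Λ] [DecidableEq ι] {g : Λ → Λ → Bool} {D : ℝ}
    (hg : ∀ A B : Finset Λ, |∑ x ∈ A, ∑ y ∈ B, sgn (g x y)| ≤ D) (z : ι → Bool)
    {X Y A B : Finset (ι → Λ)} (hA : A ⊆ X) (hB : B ⊆ Y) {J : Finset ι} {a b : ℝ} (ha0 : 0 ≤ a)
    (hb0 : 0 ≤ b)
    (ha : ∀ I ⊆ J, ∀ w : ι → Λ,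
      ((X.filter fun x => ∀ i ∈ I, x i = w i).card : ℝ) ≤ a ^ I.card * X.card)
    (hb : ∀ I ⊆ J, ∀ w : ι → Λ,
      ((Y.filter fun x => ∀ i ∈ I, x i = w i).card : ℝ) ≤ b ^ I.card * Y.card) :
    |2 ^ J.card * (((A ×ˢ B).filter fun p => ∀ i ∈ J, g (p.1 i) (p.2 i) = z i).card : ℝ)
      - A.card * B.card| ≤ ((1 + 784 * D * (a * b)) ^ J.card - 1) * (X.card * Y.card) := by
  rw [two_pow_mul_card_eq_sum, ← Finset.add_sum_erase _ _ (Finset.empty_mem_powerset J)]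
  have h1 : (1 + 784 * D * (a * b)) ^ J.card - 1
      = ∑ I ∈ J.powerset.erase ∅, (784 * D * (a * b)) ^ I.card := by
    rw [← Finset.prod_const, Finset.prod_one_add,
      ← Finset.add_sum_erase _ _ (Finset.empty_mem_powerset J)]
    simp
  rw [h1, Finset.sum_mul]
  simp only [Finset.prod_empty, Finset.sum_const, nsmul_eq_mul, mul_one, one_mul,
    add_sub_cancel_left]
  refine (Finset.abs_sum_le_sum_abs _ _).trans (Finset.sum_le_sum fun I hI => ?_)
  have hIJ := Finset.mem_powerset.1 (Finset.mem_of_mem_erase hI)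
  rw [abs_mul, Finset.abs_prod, Finset.prod_congr rfl fun i _ => abs_sgn (z i),
    Finset.prod_const_one, one_mul]
  -- Subsets inherit fiber bounds only in absolute size, so the error is measured against `X × Y`
  -- and not against `A × B`.
  have hmono : ∀ {S T : Finset (ι → Λ)} {s : ℝ}, S ⊆ T →
      (∀ w : ι → Λ, ((T.filter fun x => ∀ i ∈ I, x i = w i).card : ℝ) ≤ s) →
      ∀ w : ι → Λ, ((S.filter fun x => ∀ i ∈ I, x i = w i).card : ℝ) ≤ s := fun hST h w =>
    (Nat.cast_le.2 (Finset.card_le_card (Finset.filter_subset_filter _ hST))).trans (h w)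
  refine (abs_sum_sum_prod_sgn_le hg (by positivity) (by positivity) (hmono hA (ha I hIJ))
    (hmono hB (hb I hIJ))).trans (le_of_eq ?_)
  rw [mul_pow _ (a * b), mul_pow a b]; ring

end Counting

/-! ### Elementary estimates for the error term and for quotients. -/

section Numeric

lemma one_add_pow_sub_one_le {q : ℝ} {m n : ℕ} (hq : 0 ≤ q) (hmn : m ≤ n) (h : n * q ≤ 1) :
    (1 + q) ^ m - 1 ≤ 2 * (n * q) := by
  have h1 : (1 + q) ^ m ≤ Real.exp (n * q) := by
    calc (1 + q) ^ m ≤ (1 + q) ^ n := pow_le_pow_right₀ (by linarith) hmn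
      _ ≤ Real.exp q ^ n := pow_le_pow_left₀ (by linarith) (by linarith [Real.add_one_le_exp q]) n
      _ = Real.exp (n * q) := (Real.exp_nat_mul q n).symm
  have h0 : 0 ≤ n * q := by positivity
  have h2 := (abs_le.1 (Real.abs_exp_sub_one_le (x := n * q) (by rwa [abs_of_nonneg h0]))).2
  rw [abs_of_nonneg h0] at h2
  linarith

/-- Both counts are off by at most `ε W` and `T * N ≥ W / 2`, so the numerator `2 ε W²` over `W * W
/ 2` gives `4 ε`. -/
lemma abs_div_sub_div_le {T N NA V W ε : ℝ} (hW : 0 < W) (hV0 : 0 ≤ V)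
    (hVW : V ≤ W) (hε : ε ≤ 1 / 2) (hA : |T * NA - V| ≤ ε * W) (hN : |T * N - W| ≤ ε * W) :
    |V / W - NA / N| ≤ 4 * ε := by
  have hε0 : 0 ≤ ε := by
    by_contra! h
    have := (abs_nonneg _).trans hA
    nlinarith
  have hu : W / 2 ≤ T * N := by
    have := (abs_le.1 hN).1
    nlinarith
  have hu0 : 0 < T * N := by linarith
  have hT : T ≠ 0 := by rintro rfl; simp at hu0
  have hN0 : N ≠ 0 := by rintro rfl; simp at hu0
  have e : V / W - NA / N = (V * (T * N - W) - W * (T * NA - V)) / (W * (T * N)) := by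
    field_simp
    ring
  rw [e, abs_div, abs_of_pos (mul_pos hW hu0), div_le_iff₀ (mul_pos hW hu0)]
  calc _ ≤ |V * (T * N - W)| + |W * (T * NA - V)| := abs_sub _ _
    _ ≤ W * (ε * W) + W * (ε * W) := by
        rw [abs_mul, abs_mul, abs_of_nonneg hV0, abs_of_pos hW]
        gcongr
    _ ≤ 4 * ε * (W * (T * N)) := by
        have := mul_le_mul_of_nonneg_left hu (mul_nonneg hε0 hW.le)
        nlinarith

end Numeric

/-! ### Uniform measures, min-entropy, and discrepancy as counts. -/

section Probability

lemma uniformOn_real_eq {α : Type*} [MeasurableSpace α] [MeasurableSingletonClass α]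
    [DecidableEq α] (s : Finset α) (E : Set α) [DecidablePred (· ∈ E)] :
    (uniformOn (s : Set α)).real E = ((s.filter (· ∈ E)).card : ℝ) / s.card := by
  have h : uniformOn (s : Set α) E = uniformOn (s : Set α) ((s.filter (· ∈ E) : Finset α) : Set α) := by
    rw [← uniformOn_inter_self s.finite_toSet]
    congr 1
    ext x; simp
  rw [Measure.real, h, uniformOn_apply_finset, ENNReal.toReal_div, ENNReal.toReal_natCast,
    ENNReal.toReal_natCast, Finset.inter_eq_right.2 (Finset.filter_subset _ _)]

/-- Every exponent below the supremum is admissible; continuity of `2 ^ (-l)` carries the bound to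
the limit. -/
lemma minEntropy_spec {Ω α : Type*} [MeasurableSpace Ω] {μ : Measure Ω} [IsProbabilityMeasure μ]
    [Finite α] {X : Ω → α} {k : ℝ} (h : k ≤ minEntropy μ X) (x : α) :
    μ.real (X ⁻¹' {x}) ≤ 2 ^ (-k) := by
  have hlt : ∀ l < k, μ.real (X ⁻¹' {x}) ≤ (2 : ℝ) ^ (-l) := by
    intro l hl
    have hne : {k : ℝ | ∀ x : α, μ.real (X ⁻¹' {x}) ≤ (2 : ℝ) ^ (-k)}.Nonempty :=
      ⟨0, fun x => by simp [measureReal_le_one]⟩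
    obtain ⟨l', hl', hll'⟩ := exists_lt_of_lt_csSup hne (hl.trans_le h)
    exact (hl' x).trans (Real.rpow_le_rpow_of_exponent_le one_le_two (by linarith))
  have hcont : Filter.Tendsto (fun l : ℝ => (2 : ℝ) ^ (-l)) (nhdsWithin k (Set.Iio k))
      (nhds ((2 : ℝ) ^ (-k))) :=
    ((Real.continuous_const_rpow two_ne_zero).comp continuous_neg).continuousAt.mono_left
      nhdsWithin_le_nhds
  exact ge_of_tendsto hcont (Filter.eventually_of_mem self_mem_nhdsWithin fun l hl => hlt l hl)

lemma sum_sgn_eq_card_sub_card {Λ : Type*} (g : Λ → Λ → Bool) (A B : Finset Λ) :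
    ∑ x ∈ A, ∑ y ∈ B, sgn (g x y) = (((A ×ˢ B).filter fun p => g p.1 p.2 = false).card : ℝ)
      - ((A ×ˢ B).filter fun p => g p.1 p.2 = true).card := by
  rw [← Finset.sum_product', Finset.card_filter, Finset.card_filter, Nat.cast_sum, Nat.cast_sum,
    ← Finset.sum_sub_distrib]
  refine Finset.sum_congr rfl fun p _ => ?_
  cases g p.1 p.2 <;> simp [sgn]

lemma abs_sum_sgn_le_disc {Λ : Type*} [Fintype Λ] [Nonempty Λ] (g : Λ → Λ → Bool)
    (A B : Finset Λ) :
    |∑ x ∈ A, ∑ y ∈ B, sgn (g x y)| ≤ disc g * (Fintype.card Λ : ℝ) ^ 2 := by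
  have h : rectDisc g A B ≤ disc g :=
    le_ciSup (f := fun R : Finset Λ × Finset Λ => rectDisc g R.1 R.2) (Set.finite_range _).bddAbove
      (A, B)
  have hN : (0 : ℝ) < (Fintype.card Λ : ℝ) ^ 2 := by
    have : 0 < Fintype.card Λ := Fintype.card_pos
    positivity
  rw [rectDisc, ← sub_div, ← sum_sgn_eq_card_sub_card, abs_div, Fintype.card_prod, Nat.cast_mul,
    ← sq, abs_of_pos hN, div_le_iff₀ hN] at h
  exact h

lemma IsDense.card_filter_le {Ω : Type*} [MeasurableSpace Ω] {μ : Measure Ω}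
    [IsProbabilityMeasure μ] {b n : ℕ} {X : Ω → Fin n → Block b} (hX : Measurable X)
    {S : Finset (Fin n → Block b)} (hS : S.Nonempty)
    (hXS : μ.map X = uniformOn (S : Set (Fin n → Block b))) {J : Finset (Fin n)} {δ : ℝ}
    (h : IsDense μ (proj X J) δ) {I : Finset (Fin n)} (hI : I ⊆ J) (w : Fin n → Block b) :
    ((S.filter fun x => ∀ i ∈ I, x i = w i).card : ℝ)
      ≤ ((2 : ℝ) ^ (-(δ * b))) ^ I.card * S.card := by
  have h1 := minEntropy_spec (h (I.subtype (· ∈ J))) fun i => w i.1.1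
  have hcard : (I.subtype (· ∈ J)).card = I.card := by
    rw [Finset.card_subtype, Finset.filter_true_of_mem fun i hi => hI hi]
  have e : proj (proj X J) (I.subtype (· ∈ J)) ⁻¹' {fun i => w i.1.1}
      = X ⁻¹' {x | ∀ i ∈ I, x i = w i} := by
    ext ω
    rw [Set.mem_preimage, Set.mem_singleton_iff, funext_iff]
    constructor
    · intro h i hi
      exact h ⟨⟨i, hI hi⟩, by simpa using hi⟩
    · intro h i
      exact h _ (Finset.mem_subtype.1 i.2)
  rw [e, ← map_measureReal_apply hX (Set.toFinite _).measurableSet, hXS, uniformOn_real_eq,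
    div_le_iff₀ (by exact_mod_cast hS.card_pos), hcard] at h1
  rw [← Real.rpow_natCast, ← Real.rpow_mul two_pos.le, neg_mul]
  exact h1

/-- Independence gives every pair of `S × T` positive mass, so no pair can lie in the exceptional
null set. -/
lemma forall_mem_of_ae_indep {Ω α β : Type*} [MeasurableSpace Ω] {μ : Measure Ω}
    [MeasurableSpace α] [MeasurableSingletonClass α] [MeasurableSpace β]
    [MeasurableSingletonClass β] {X : Ω → α} {Y : Ω → β} (hX : Measurable X) (hY : Measurable Y)
    (hXY : IndepFun X Y μ) {S : Finset α} {T : Finset β} (hS : μ.map X = uniformOn (S : Set α))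
    (hT : μ.map Y = uniformOn (T : Set β)) {P : α → β → Prop} (h : ∀ᵐ ω ∂μ, P (X ω) (Y ω))
    {x : α} (hx : x ∈ S) {y : β} (hy : y ∈ T) : P x y := by
  by_contra hP
  have h0 : μ (X ⁻¹' {x} ∩ Y ⁻¹' {y}) = 0 := by
    refine measure_mono_null (fun ω hω => ?_) h
    obtain ⟨h1, h2⟩ := hω
    simp only [Set.mem_preimage, Set.mem_singleton_iff] at h1 h2
    simpa [h1, h2] using hP
  rw [hXY.measure_inter_preimage_eq_mul _ _ (measurableSet_singleton x) (measurableSet_singleton y),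
    mul_eq_zero, ← Measure.map_apply hX (measurableSet_singleton x),
    ← Measure.map_apply hY (measurableSet_singleton y), hS, hT,
    uniformOn_eq_zero_iff S.finite_toSet, uniformOn_eq_zero_iff T.finite_toSet] at h0
  rcases h0 with h0 | h0
  · exact (Set.mem_empty_iff_false x).1 (h0 ▸ ⟨hx, rfl⟩)
  · exact (Set.mem_empty_iff_false y).1 (h0 ▸ ⟨hy, rfl⟩)

lemma isClose_of_forall {α : Type*} [MeasurableSpace α] {μ ν : Measure α} {ε : ℝ}
    (h : ∀ E : Set α, |μ.real E - ν.real E| ≤ ε) : IsClose ε μ ν := ciSup_le h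

end Probability

end Lifting

/-! ### Choice of the constant, and the final assembly. -/

namespace Lifting

lemma base_bound {b n : ℕ} {c η γ δ d : ℝ} (hc : 0 < c) (hn : 2 ≤ n)
    (hb : c * Real.logb 2 n ≤ b) (hδ : 2 + 14 / c - η + γ ≤ δ) (hd : d ≤ (2 : ℝ) ^ (-(η * b))) :
    784 * (d * ((2 : ℝ) ^ b) ^ 2) * (2 : ℝ) ^ (-(δ * b))
      ≤ 784 * ((2 : ℝ) ^ (-(γ * b)) * ((n : ℝ) ^ 14)⁻¹) := by
  have hn0 : (0 : ℝ) < n := by positivity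
  have hb0 : (0 : ℝ) ≤ b := Nat.cast_nonneg b
  have h1 : ((n : ℝ) ^ 14)⁻¹ = (2 : ℝ) ^ (-(14 * Real.logb 2 n)) := by
    rw [Real.rpow_neg two_pos.le, mul_comm, Real.rpow_mul two_pos.le,
      Real.rpow_logb two_pos (by norm_num) hn0]
    norm_cast
  have h2 : ((2 : ℝ) ^ b) ^ 2 = (2 : ℝ) ^ (2 * b : ℝ) := by
    rw [← pow_mul, ← Real.rpow_natCast]
    push_cast
    rw [mul_comm]
  have h3 : 14 * Real.logb 2 n ≤ 14 / c * b := by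
    rw [div_mul_eq_mul_div, le_div_iff₀ hc]
    linarith
  rw [mul_assoc]
  refine mul_le_mul_of_nonneg_left ?_ (by norm_num)
  calc _ ≤ (2 : ℝ) ^ (-(η * b)) * (2 : ℝ) ^ (2 * b : ℝ) * (2 : ℝ) ^ (-(δ * b)) := by
        rw [h2]; gcongr
    _ = (2 : ℝ) ^ (-(η * b) + 2 * b + -(δ * b)) := by
        rw [Real.rpow_add two_pos, Real.rpow_add two_pos]
    _ ≤ (2 : ℝ) ^ (-(γ * b) + -(14 * Real.logb 2 n)) := by
        refine Real.rpow_le_rpow_of_exponent_le one_le_two ?_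
        have := mul_le_mul_of_nonneg_right hδ hb0
        linarith
    _ = _ := by rw [Real.rpow_add two_pos, h1]

lemma excess_bound {n m : ℕ} {q e : ℝ} (hn : 2 ≤ n) (hm : m ≤ n) (hq : 0 ≤ q) (he : 0 < e)
    (he1 : e ≤ 1) (h : q ≤ 784 * (e * ((n : ℝ) ^ 14)⁻¹)) :
    4 * ((1 + q) ^ m - 1) ≤ e := by
  have hn2 : (2 : ℝ) ≤ n := by exact_mod_cast hn
  -- One factor of `n ^ 14` pays for the number of coordinates; the other `n ^ 13 ≥ 8192` absorbs
  -- `784 * 8 = 6272`.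
  have h13 : (2 : ℝ) ^ 13 ≤ (n : ℝ) ^ 13 := pow_le_pow_left₀ (by norm_num) hn2 13
  have hnq : n * q ≤ e / 8 := by
    calc n * q ≤ n * (784 * (e * ((n : ℝ) ^ 14)⁻¹)) := by gcongr
      _ = 784 * e / (n : ℝ) ^ 13 := by field_simp
      _ ≤ e / 8 := by
        rw [div_le_iff₀ (by positivity)]
        nlinarith
  have := one_add_pow_sub_one_le hq hm (by linarith)
  linarith

end Lifting

open MeasureTheory ProbabilityTheory Lifting in
theorem mainTheorem5 :
    ∃ h : ℝ, 0 < h ∧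
      ∀ (η : ℝ), 0 < η →
      ∀ (c : ℕ), 0 < c →
      ∀ (n b : ℕ), 2 ≤ n → (c : ℝ) * Real.logb 2 (n : ℝ) ≤ (b : ℝ) →
      ∀ (g : Lifting.Block b → Lifting.Block b → Bool),
        Lifting.disc g ≤ (2 : ℝ) ^ (-(η * (b : ℝ))) →
      ∀ (γ : ℝ), 0 < γ →
      ∀ (ρ : Lifting.Restriction n) (z : Fin n → Bool), ρ.Consistent z →
      ∀ (Ω : Type*) [MeasurableSpace Ω] (μ : Measure Ω) [IsProbabilityMeasure μ]
        (X Y : Ω → Fin n → Lifting.Block b), Measurable X → Measurable Y →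
      ∀ (𝒳 𝒴 : Set (Fin n → Lifting.Block b)),
        μ.map X = uniformOn 𝒳 → μ.map Y = uniformOn 𝒴 →
      ∀ (τ : ℝ), 2 + h / (c : ℝ) - η + γ ≤ τ → Lifting.IsStructured μ g X Y ρ τ →
        (Lifting.fiber g z 𝒳 𝒴).Nonempty ∧
        Lifting.IsClose ((2 : ℝ) ^ (-(γ * (b : ℝ)))) (μ.map X)
          ((uniformOn (Lifting.fiber g z 𝒳 𝒴)).map Prod.fst) ∧
        Lifting.IsClose ((2 : ℝ) ^ (-(γ * (b : ℝ)))) (μ.map Y)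
          ((uniformOn (Lifting.fiber g z 𝒳 𝒴)).map Prod.snd) := by
  classical
  refine ⟨14, by norm_num, ?_⟩
  intro η _ c hc n b hn hb g hg γ hγ ρ z hz Ω _ μ _ X Y hX hY 𝒳 𝒴 hX𝒳 hY𝒴 τ hτ
    ⟨_, hXY, ⟨δX, δY, _, _, hdX, hdY, hδ⟩, hfix⟩
  obtain ⟨S, rfl⟩ : ∃ S : Finset (Fin n → Block b), (S : Set (Fin n → Block b)) = 𝒳 :=
    ⟨(Set.toFinite 𝒳).toFinset, by simp⟩
  obtain ⟨T, rfl⟩ : ∃ T : Finset (Fin n → Block b), (T : Set (Fin n → Block b)) = 𝒴 :=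
    ⟨(Set.toFinite 𝒴).toFinset, by simp⟩
  have hS : S.Nonempty := by
    rw [Finset.nonempty_iff_ne_empty]
    rintro rfl
    have := Measure.isProbabilityMeasure_map (μ := μ) hX.aemeasurable
    rw [hX𝒳] at this
    exact this.ne_zero _ (by simp)
  have hT : T.Nonempty := by
    rw [Finset.nonempty_iff_ne_empty]
    rintro rfl
    have := Measure.isProbabilityMeasure_map (μ := μ) hY.aemeasurable
    rw [hY𝒴] at this
    exact this.ne_zero _ (by simp)
  have hfixed : ∀ x ∈ S, ∀ y ∈ T, ∀ i ∈ ρ.fix, g (x i) (y i) = z i := by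
    intro x hx y hy i hi
    have h := forall_mem_of_ae_indep hX hY hXY hX𝒳 hY𝒴
      (P := fun x y => ∀ i : ρ.fix, some (g (x i) (y i)) = ρ i) hfix hx hy ⟨i, hi⟩
    exact Option.some_injective _ (h.trans (hz i hi).symm)
  set F : Finset (Fin n → Block b) → Finset (Fin n → Block b) →
      Finset ((Fin n → Block b) × (Fin n → Block b)) := fun A B =>
    (A ×ˢ B).filter fun p => ∀ i ∈ ρ.free, g (p.1 i) (p.2 i) = z i with hF
  -- The conditions on the fixed coordinates hold on all of `S × T`, so the fiber is cut out by the
  -- free ones alone.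
  have hfiber : fiber g z (S : Set (Fin n → Block b)) T = (F S T : Set _) := by
    ext ⟨x, y⟩
    simp only [fiber, hF, Finset.coe_filter, Finset.mem_product, Set.mem_inter_iff,
      Set.mem_ofPred_eq, Set.mem_prod, Finset.mem_coe, blockwise, funext_iff]
    constructor
    · rintro ⟨h, hxy⟩
      exact ⟨hxy, fun i _ => h i⟩
    · rintro ⟨hxy, h⟩
      refine ⟨fun i => ?_, hxy⟩
      by_cases hi : ρ i = none
      · exact h i (by simp [Restriction.free, hi])
      · exact hfixed x hxy.1 y hxy.2 i (by simp [Restriction.fix, hi])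
  set e : ℝ := (2 : ℝ) ^ (-(γ * b)) with he
  have he0 : 0 < e := Real.rpow_pos_of_pos two_pos _
  have he1 : e ≤ 1 := Real.rpow_le_one_of_one_le_of_nonpos one_le_two (by
    have : 0 ≤ γ * b := by positivity
    linarith)
  have hcard : (Fintype.card (Block b) : ℝ) = 2 ^ b := by simp [Block]
  set q : ℝ := 784 * (disc g * (Fintype.card (Block b) : ℝ) ^ 2) *
    ((2 : ℝ) ^ (-(δX * b)) * (2 : ℝ) ^ (-(δY * b))) with hq
  have hq0 : 0 ≤ q := by
    have := (abs_nonneg _).trans (abs_sum_sgn_le_disc g ∅ ∅)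
    positivity
  have hqle : q ≤ 784 * (e * ((n : ℝ) ^ 14)⁻¹) := by
    rw [hq, hcard, ← Real.rpow_add two_pos, ← neg_add, ← add_mul]
    exact base_bound (by exact_mod_cast hc) hn hb (hτ.trans hδ) hg
  set ε : ℝ := (1 + q) ^ ρ.free.card - 1 with hε
  have hεe : 4 * ε ≤ e :=
    excess_bound hn ((Finset.card_le_univ _).trans_eq (Fintype.card_fin n)) hq0 he0 he1 hqle
  have hcount : ∀ A ⊆ S, ∀ B ⊆ T,
      |2 ^ ρ.free.card * ((F A B).card : ℝ) - A.card * B.card| ≤ ε * (S.card * T.card) :=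
    fun A hA B hB => by
      have h := abs_two_pow_mul_card_sub_le (abs_sum_sgn_le_disc g) z hA hB
        (a := (2 : ℝ) ^ (-(δX * b))) (b := (2 : ℝ) ^ (-(δY * b))) (by positivity) (by positivity)
        (fun I hI w => by convert hdX.card_filter_le hX hS hX𝒳 hI w)
        (fun I hI w => by convert hdY.card_filter_le hY hT hY𝒴 hI w)
      convert h
  have hS0 : (0 : ℝ) < S.card := by exact_mod_cast hS.card_pos
  have hT0 : (0 : ℝ) < T.card := by exact_mod_cast hT.card_pos
  -- The power `2 ^ |free|` cancels in the quotient of the two counts. Taking `B = T` or `A = S`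
  -- below turns this into a statement about one marginal.
  have hclose : ∀ A ⊆ S, ∀ B ⊆ T,
      |((A.card : ℝ) * B.card) / (S.card * T.card) - (F A B).card / (F S T).card| ≤ e :=
    fun A hA B hB => (abs_div_sub_div_le (mul_pos hS0 hT0) (by positivity)
      (by gcongr) (by linarith) (hcount A hA B hB) (hcount S subset_rfl T subset_rfl)).trans hεe
  rw [hfiber, hX𝒳, hY𝒴]
  refine ⟨?_, isClose_of_forall fun E => ?_, isClose_of_forall fun E => ?_⟩
  · rw [Finset.coe_nonempty, Finset.nonempty_iff_ne_empty]
    intro h0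
    have h := hcount S subset_rfl T subset_rfl
    rw [h0, Finset.card_empty, Nat.cast_zero, mul_zero, zero_sub, abs_neg,
      abs_of_pos (mul_pos hS0 hT0)] at h
    -- An empty fiber would force `ε ≥ 1`, whereas `4 ε ≤ e ≤ 1`.
    have := mul_pos hS0 hT0
    nlinarith
  · rw [map_measureReal_apply measurable_fst (Set.toFinite _).measurableSet, uniformOn_real_eq,
      uniformOn_real_eq]
    have h := hclose (S.filter (· ∈ E)) (Finset.filter_subset _ _) T subset_rfl
    rw [mul_div_mul_right _ _ hT0.ne'] at h
    have hFE : F (S.filter (· ∈ E)) T = (F S T).filter (· ∈ Prod.fst ⁻¹' E) := by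
      ext p
      simp only [hF, Finset.mem_filter, Finset.mem_product, Set.mem_preimage]
      tauto
    rw [hFE] at h
    convert h
  · rw [map_measureReal_apply measurable_snd (Set.toFinite _).measurableSet, uniformOn_real_eq,
      uniformOn_real_eq]
    have h := hclose S subset_rfl (T.filter (· ∈ E)) (Finset.filter_subset _ _)
    rw [mul_div_mul_left _ _ hS0.ne'] at h
    have hFE : F S (T.filter (· ∈ E)) = (F S T).filter (· ∈ Prod.snd ⁻¹' E) := by
      ext p
      simp only [hF, Finset.mem_filter, Finset.mem_product, Set.mem_preimage]
      tauto
    rw [hFE] at h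
    convert h
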